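/- Rings are associative with unit. A left (right) $R$-module $M$ is FP-injective if $\operatorname{Ext}^1_R(F,M)=0$ for every finitely presented left (right) $R$-module $F$; the ring $R$ is two-sided FP-injective if ${}_RR$ and $R_R$ are FP-injective, and two-sided coherent if every finitely generated left ideal and every finitely generated right ideal is finitely presented. The ring $R$ is weakly quasi-Frobenius if it determines an $R$-duality between the finitely presented left and the finitely presented right $R$-modules: the dual $M^*=\operatorname{Hom}_R(M,R)$ of every finitely presented left or right $R$-module $M$ is a finitely presented module on the other side, and the evaluation map $M\to M^{**}$ is an isomorphism. (Weakly quasi-Frobenius rings can also be described as the rings that are two-sided coherent and two-sided FP-injective.) A group is locally finite if each of its finitely generated subgroups is finite. Theorem. Let $R$ be a nonzero ring and $G$ a group. The group ring $R(G)$ is weakly quasi-Frobenius if and only if $R$ is weakly quasi-Frobenius and $G$ is locally finite. The same equivalence holds in terms of the second description: $R(G)$ is two-sided coherent and two-sided FP-injective if and only if $R$ is two-sided coherent and two-sided FP-injective and $G$ is locally finite. -/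

import Mathlib

open CategoryTheory

universe u v

noncomputable section

/-- The group `G` is locally finite: every finitely generated subgroup is finite. -/
def IsLocallyFiniteGroup (G : Type v) [Group G] : Prop :=
  ∀ H : Subgroup G, H.FG → Finite H

section Rings

/-! Left modules over `S` are modules over `S`; right modules over `S` are modules over the
opposite ring `Sᵐᵒᵖ`. The ring `S` itself is a left and a right module in this way. -/

variable (S : Type u) [Ring S]

/-- `S` is left coherent: every finitely generated left ideal is finitely presented. -/
def IsLeftCoherent : Prop :=
  ∀ I : Submodule S S, I.FG → Module.FinitePresentation S I

/-- `S` is right coherent: every finitely generated right ideal is finitely presented. -/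
def IsRightCoherent : Prop :=
  ∀ I : Submodule Sᵐᵒᵖ S, I.FG → Module.FinitePresentation Sᵐᵒᵖ I

/-- `M` is an FP-injective `S`-module: `Ext¹_S(F, M) = 0` for every finitely presented `F`. -/
def IsFPInjectiveModule (M : Type u) [AddCommGroup M] [Module S M] : Prop :=
  ∀ (F : Type u) [AddCommGroup F] [Module S F], Module.FinitePresentation S F →
    Subsingleton (Abelian.Ext (ModuleCat.of S F) (ModuleCat.of S M) 1)

/-- `S` is left FP-injective: `S` is FP-injective as a left module over itself. -/
def IsLeftFPInjective : Prop := IsFPInjectiveModule S S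

/-- `S` is right FP-injective: `S` is FP-injective as a right module over itself. -/
def IsRightFPInjective : Prop := IsFPInjectiveModule Sᵐᵒᵖ S

/-- The dual `M* = Hom_S(M, S)` of a left `S`-module; it is a right `S`-module through
`(f · s) m = f m * s`. -/
abbrev LeftModuleDual (M : Type u) [AddCommGroup M] [Module S M] : Type u := M →ₗ[S] S

/-- The dual `N* = Hom_S(N, S)` of a right `S`-module; it is a left `S`-module through
`(s · f) n = s * f n`. -/
abbrev RightModuleDual (N : Type u) [AddCommGroup N] [Module Sᵐᵒᵖ N] : Type u := N →ₗ[Sᵐᵒᵖ] S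

/-- The evaluation map `M → M**`, `m ↦ (f ↦ f m)`, of a left `S`-module `M`. -/
def leftModuleEval (M : Type u) [AddCommGroup M] [Module S M] :
    M →ₗ[S] RightModuleDual S (LeftModuleDual S M) where
  toFun m :=
    { toFun := fun f => f m
      map_add' := fun _ _ => rfl
      map_smul' := fun _ _ => rfl }
  map_add' m m' := by ext f; exact map_add f m m'
  map_smul' s m := by ext f; exact map_smul f s m

/-- The evaluation map `N → N**`, `n ↦ (f ↦ f n)`, of a right `S`-module `N`. -/
def rightModuleEval (N : Type u) [AddCommGroup N] [Module Sᵐᵒᵖ N] :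
    N →ₗ[Sᵐᵒᵖ] LeftModuleDual S (RightModuleDual S N) where
  toFun n :=
    { toFun := fun f => f n
      map_add' := fun _ _ => rfl
      map_smul' := fun _ _ => rfl }
  map_add' n n' := by ext f; exact map_add f n n'
  map_smul' s n := by ext f; exact map_smul f s n

/-- `S` is weakly quasi-Frobenius: the functors `Hom_S(-, S)` are a duality between the categories
of finitely presented left and of finitely presented right `S`-modules. That is, they carry
finitely presented modules to finitely presented modules, and the natural evaluation maps into the
double duals are isomorphisms on finitely presented modules. -/
structure IsWeaklyQuasiFrobenius : Prop where
  finitePresentation_leftDual : ∀ (M : Type u) [AddCommGroup M] [Module S M],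
    Module.FinitePresentation S M → Module.FinitePresentation Sᵐᵒᵖ (LeftModuleDual S M)
  finitePresentation_rightDual : ∀ (N : Type u) [AddCommGroup N] [Module Sᵐᵒᵖ N],
    Module.FinitePresentation Sᵐᵒᵖ N → Module.FinitePresentation S (RightModuleDual S N)
  bijective_leftEval : ∀ (M : Type u) [AddCommGroup M] [Module S M],
    Module.FinitePresentation S M → Function.Bijective (leftModuleEval S M)
  bijective_rightEval : ∀ (N : Type u) [AddCommGroup N] [Module Sᵐᵒᵖ N],
    Module.FinitePresentation Sᵐᵒᵖ N → Function.Bijective (rightModuleEval S N)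

/-- `S` is left and right coherent and left and right FP-injective. -/
structure IsCoherentFPInjective : Prop where
  leftCoherent : IsLeftCoherent S
  rightCoherent : IsRightCoherent S
  leftFPInjective : IsLeftFPInjective S
  rightFPInjective : IsRightFPInjective S

end Rings

end

/-! Both descriptions reduce to two conditions on matrices over `T`, imposed on `S` and on `Sᵐᵒᵖ`.
Left coherence says that the row vectors killing a matrix form a finitely generated left module.
Left FP-injectivity says that `A c = b` is solvable as soon as every row vector killing `A` kills
`b`. If `M` is the cokernel of a map `g` of free modules, then `M*` is the kernel of the transpose
of `g`. Hence finite presentation of duals is coherence on the other side, and evaluation is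
injective on all finitely presented modules exactly when the other side is FP-injective.
Surjectivity of evaluation then follows from coherence and FP-injectivity together
(`isWeaklyQuasiFrobenius_iff`).

For group rings, both conditions descend to `R` through coefficients and augmentation. Applied to
the row of elements `g - 1`, with `g` running over generators of a subgroup, the second condition
forces that subgroup to be finite (`HasDoubleAnnihilators.isLocallyFiniteGroup`). Conversely, if `G`
is locally finite, a matrix over `R(G)` is supported on a finite subgroup `H`. It acts on row
vectors one left coset `sH` at a time, always by the same finite matrix over `R`
(`vecMul_flattenMatrix`), so both conditions ascend. The right-hand versions follow from `R(G)ᵐᵒᵖ ≅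
Rᵐᵒᵖ(Gᵐᵒᵖ)`. -/

section MatrixConditions

/-- Left annihilators of matrices over `T` are finitely generated. -/
def HasFGLeftAnnihilators (T : Type u) [Ring T] : Prop :=
  ∀ (n m : ℕ) (A : Matrix (Fin n) (Fin m) T), ∃ (k : ℕ) (B : Matrix (Fin k) (Fin n) T),
    B * A = 0 ∧ ∀ x, Matrix.vecMul x A = 0 → ∃ z, Matrix.vecMul z B = x

/-- A column vector that is annihilated by the left annihilator of a matrix `A` over `T` lies in
the column space of `A`. -/
def HasDoubleAnnihilators (T : Type u) [Ring T] : Prop :=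
  ∀ (n m : ℕ) (A : Matrix (Fin n) (Fin m) T) (b : Fin n → T),
    (∀ x, Matrix.vecMul x A = 0 → x ⬝ᵥ b = 0) → ∃ c, A.mulVec c = b

variable {T : Type u} [Ring T]

theorem HasFGLeftAnnihilators.exists_matrix (h : HasFGLeftAnnihilators T) {ι κ : Type*}
    [Fintype ι] [Fintype κ] (A : Matrix ι κ T) :
    ∃ (k : ℕ) (B : Matrix (Fin k) ι T),
      B * A = 0 ∧ ∀ x, Matrix.vecMul x A = 0 → ∃ z, Matrix.vecMul z B = x := by
  let e := Fintype.equivFin ι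
  let e' := Fintype.equivFin κ
  obtain ⟨k, B, hB, hx⟩ := h _ _ (A.submatrix e.symm e'.symm)
  refine ⟨k, B.submatrix id e, ?_, fun x hxA => ?_⟩
  · have h1 := congrArg (fun M => M.submatrix id e') hB
    have h2 := Matrix.submatrix_mul_equiv B (A.submatrix e.symm e'.symm) id e e'
    simpa [← h2] using h1
  · obtain ⟨z, hz⟩ := hx (x ∘ e.symm) (by
      rw [Matrix.submatrix_vecMul_equiv]
      simp [Function.comp_assoc, hxA])
    refine ⟨z, ?_⟩
    ext i
    have := congrFun hz (e i)
    simpa [Matrix.vecMul, dotProduct] using this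

theorem HasDoubleAnnihilators.exists_mulVec_eq (h : HasDoubleAnnihilators T) {ι κ : Type*}
    [Fintype ι] [Fintype κ] (A : Matrix ι κ T) (b : ι → T)
    (hb : ∀ x, Matrix.vecMul x A = 0 → x ⬝ᵥ b = 0) : ∃ c, A.mulVec c = b := by
  let e := Fintype.equivFin ι
  let e' := Fintype.equivFin κ
  obtain ⟨c, hc⟩ := h _ _ (A.submatrix e.symm e'.symm) (b ∘ e.symm) (fun x hx => by
    have hx' : Matrix.vecMul (x ∘ e) A = 0 := by
      rw [Matrix.submatrix_vecMul_equiv] at hx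
      ext j
      simpa using congrFun hx (e' j)
    rw [dotProduct_comp_equiv_symm]
    exact hb _ hx')
  refine ⟨c ∘ e', ?_⟩
  rw [Matrix.submatrix_mulVec_equiv] at hc
  ext i
  simpa using congrFun hc (e i)

theorem HasFGLeftAnnihilators.of_ringEquiv {T' : Type v} [Ring T'] (e : T ≃+* T')
    (h : HasFGLeftAnnihilators T) : HasFGLeftAnnihilators T' := by
  intro n m A
  obtain ⟨k, B, hB, hx⟩ := h n m (A.map e.symm)
  refine ⟨k, B.map e, ?_, fun x hxA => ?_⟩
  · have := congrArg (fun M => M.map e) hB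
    simpa [Matrix.map_mul, Function.comp_def] using this
  · obtain ⟨z, hz⟩ := hx (e.symm ∘ x) (by
      ext j
      have := RingHom.map_vecMul (e.symm : T' →+* T) A x j
      simpa [hxA] using this.symm)
    refine ⟨e ∘ z, ?_⟩
    ext j
    have := RingHom.map_vecMul (e : T →+* T') B z j
    simpa [hz] using this.symm

theorem HasDoubleAnnihilators.of_ringEquiv {T' : Type v} [Ring T'] (e : T ≃+* T')
    (h : HasDoubleAnnihilators T) : HasDoubleAnnihilators T' := by
  intro n m A b hb
  obtain ⟨c, hc⟩ := h n m (A.map e.symm) (e.symm ∘ b) (fun x hx => by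
    have h1 : Matrix.vecMul (e ∘ x) A = 0 := by
      ext j
      have := RingHom.map_vecMul (e : T →+* T') (A.map e.symm) x j
      simpa [hx, Function.comp_def] using this.symm
    apply e.injective
    have h2 := RingHom.map_dotProduct (e : T →+* T') x (e.symm ∘ b)
    simpa [Function.comp_def, ← hb _ h1] using h2)
  refine ⟨e ∘ c, ?_⟩
  ext i
  have := RingHom.map_mulVec (e : T →+* T') (A.map e.symm) c i
  simpa [hc, Function.comp_def] using this.symm

end MatrixConditions

/-! ### Coordinate-free forms, for a module `P` isomorphic to the ring -/

section ModuleConditions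

variable (T : Type u) [Ring T] (P : Type v) [AddCommGroup P] [Module T P]

/-- Linear maps between finite powers of `P` have finitely generated kernels. -/
def HasFGKernels : Prop :=
  ∀ (n m : ℕ) (f : (Fin n → P) →ₗ[T] (Fin m → P)), (LinearMap.ker f).FG

/-- Linear maps into `P` extend from images of linear maps between finite powers of `P`. -/
def ExtendsFromImages : Prop :=
  ∀ (n m : ℕ) (f : (Fin n → P) →ₗ[T] (Fin m → P)) (g : (Fin n → P) →ₗ[T] P),
    LinearMap.ker f ≤ LinearMap.ker g → ∃ h : (Fin m → P) →ₗ[T] P, h ∘ₗ f = g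

variable {T P} {P' : Type*} [AddCommGroup P'] [Module T P']

theorem HasFGKernels.of_linearEquiv (e : P ≃ₗ[T] P') (h : HasFGKernels T P) :
    HasFGKernels T P' := by
  intro n m f
  have := h n m ((LinearEquiv.piCongrRight fun _ => e).symm.toLinearMap ∘ₗ f ∘ₗ
    (LinearEquiv.piCongrRight fun _ => e).toLinearMap)
  rw [LinearEquiv.ker_comp, LinearMap.ker_comp] at this
  have := this.map (LinearEquiv.piCongrRight fun _ : Fin n => e).toLinearMap
  rwa [Submodule.map_comap_eq_of_surjective (LinearEquiv.surjective _)] at this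

theorem ExtendsFromImages.of_linearEquiv (e : P ≃ₗ[T] P') (h : ExtendsFromImages T P) :
    ExtendsFromImages T P' := by
  intro n m f g hfg
  obtain ⟨k, hk⟩ := h n m ((LinearEquiv.piCongrRight fun _ => e).symm.toLinearMap ∘ₗ f ∘ₗ
    (LinearEquiv.piCongrRight fun _ => e).toLinearMap) (e.symm.toLinearMap ∘ₗ g ∘ₗ
    (LinearEquiv.piCongrRight fun _ => e).toLinearMap) (by
      rw [LinearEquiv.ker_comp, LinearMap.ker_comp, LinearEquiv.ker_comp, LinearMap.ker_comp]
      exact Submodule.comap_mono hfg)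
  refine ⟨e.toLinearMap ∘ₗ k ∘ₗ (LinearEquiv.piCongrRight fun _ => e).symm.toLinearMap,
    LinearMap.ext fun x => ?_⟩
  have := LinearMap.congr_fun hk ((LinearEquiv.piCongrRight fun _ => e).symm x)
  simp only [LinearMap.comp_apply, LinearEquiv.coe_coe, LinearEquiv.apply_symm_apply] at this ⊢
  rw [this, LinearEquiv.apply_symm_apply]

theorem hasFGKernels_self_iff : HasFGKernels T T ↔ HasFGLeftAnnihilators T := by
  constructor
  · intro h n m A
    obtain ⟨k, f, hf⟩ := (Submodule.fg_iff_exists_fin_linearMap _ _).1 (h n m A.toLinearMapRight')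
    refine ⟨k, f.toMatrixRight', ?_, fun x hx => ?_⟩
    · apply Matrix.toLinearMapRight'.injective
      rw [Matrix.toLinearMapRight'_mul, map_zero]
      refine LinearMap.ext fun x => ?_
      have : f x ∈ LinearMap.ker A.toLinearMapRight' := hf ▸ LinearMap.mem_range_self f x
      simpa using this
    · have : x ∈ LinearMap.range f := by rw [hf]; exact hx
      obtain ⟨z, rfl⟩ := this
      refine ⟨z, ?_⟩
      rw [← Matrix.toLinearMapRight'_apply]
      simp
  · intro h n m f
    obtain ⟨k, B, hB, hx⟩ := h n m f.toMatrixRight'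
    refine (Submodule.fg_iff_exists_fin_linearMap _ _).2 ⟨k, B.toLinearMapRight', ?_⟩
    have hf : ∀ x, f x = Matrix.vecMul x f.toMatrixRight' := fun x => by
      rw [← Matrix.toLinearMapRight'_apply]
      simp
    ext x
    constructor
    · rintro ⟨z, rfl⟩
      rw [LinearMap.mem_ker, hf, Matrix.toLinearMapRight'_apply, Matrix.vecMul_vecMul, hB,
        Matrix.vecMul_zero]
    · intro hxf
      exact hx x ((hf x).symm.trans hxf)

/-- In coordinates `f` is `x ↦ x A` and `g` is `x ↦ x ⬝ᵥ b`. A functional with coefficient column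
`c` extends `g` along `f` exactly when `A c = b`. -/
theorem extendsFromImages_self_iff : ExtendsFromImages T T ↔ HasDoubleAnnihilators T := by
  have key : ∀ {n : ℕ} (b : Fin n → T) (x : Fin n → T),
      Fintype.linearCombination T b x = x ⬝ᵥ b := fun b x => by
    simp [Fintype.linearCombination_apply, dotProduct]
  have key2 : ∀ {n : ℕ} (g : (Fin n → T) →ₗ[T] T),
      g = Fintype.linearCombination T (fun i => g (Pi.single i 1)) := fun g => by
    ext i; simp
  constructor
  · intro h n m A b hb
    obtain ⟨g, hg⟩ := h n m A.toLinearMapRight' (Fintype.linearCombination T b)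
      (fun x hx => by simpa [key] using hb x hx)
    refine ⟨fun j => g (Pi.single j 1), ?_⟩
    ext i
    have h1 := LinearMap.congr_fun hg (Pi.single i 1)
    rw [LinearMap.comp_apply, key2 g, key, key] at h1
    simpa [Matrix.mulVec, dotProduct, Pi.single_apply] using h1
  · intro h n m f g hfg
    have hf : ∀ x, f x = Matrix.vecMul x f.toMatrixRight' := fun x => by
      rw [← Matrix.toLinearMapRight'_apply]
      simp
    obtain ⟨c, hc⟩ := h n m f.toMatrixRight' (fun i => g (Pi.single i 1)) (fun x hx => by
      rw [← key, ← key2]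
      exact hfg ((hf x).trans hx))
    refine ⟨Fintype.linearCombination T c, LinearMap.ext fun x => ?_⟩
    rw [LinearMap.comp_apply, key, hf, ← Matrix.dotProduct_mulVec, hc, ← key, ← key2]

theorem hasFGKernels_iff (e : T ≃ₗ[T] P) : HasFGKernels T P ↔ HasFGLeftAnnihilators T :=
  ⟨fun h => hasFGKernels_self_iff.1 (h.of_linearEquiv e.symm),
    fun h => (hasFGKernels_self_iff.2 h).of_linearEquiv e⟩

theorem extendsFromImages_iff (e : T ≃ₗ[T] P) :
    ExtendsFromImages T P ↔ HasDoubleAnnihilators T :=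
  ⟨fun h => extendsFromImages_self_iff.1 (h.of_linearEquiv e.symm),
    fun h => (extendsFromImages_self_iff.2 h).of_linearEquiv e⟩

end ModuleConditions

/-! ### Coherence and finitely generated kernels -/

section Coherence

variable {T : Type u} [Ring T] {P : Type v} [AddCommGroup P] [Module T P]

theorem Module.finitePresentation_of_injective {M N : Type*} [AddCommGroup M] [Module T M]
    [AddCommGroup N] [Module T N] (hM : ∀ K : Submodule T M, K.FG → Module.FinitePresentation T K)
    [Module.Finite T N] (j : N →ₗ[T] M) (hj : Function.Injective j) :
    Module.FinitePresentation T N :=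
  have := hM (LinearMap.range j) (Module.Finite.iff_fg.1 inferInstance)
  Module.FinitePresentation.of_equiv (LinearEquiv.ofInjective j hj).symm

/-- Dropping the first coordinate presents `K` as an extension of a submodule of `Pⁿ` by a submodule
of `P`. The kernel is finitely generated because the image is finitely presented, so both ends are
finitely presented. -/
theorem Module.finitePresentation_of_fg_pi
    (h : ∀ K : Submodule T P, K.FG → Module.FinitePresentation T K) (n : ℕ) :
    ∀ K : Submodule T (Fin n → P), K.FG → Module.FinitePresentation T K := by
  induction n with
  | zero =>
    intro K _
    have : Subsingleton K := inferInstance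
    infer_instance
  | succ n ih =>
    intro K hK
    let l : K →ₗ[T] (Fin n → P) := LinearMap.funLeft T P Fin.succ ∘ₗ K.subtype
    have : Module.Finite T K := Module.Finite.iff_fg.2 hK
    have h1 : Module.FinitePresentation T (LinearMap.range l) :=
      ih _ (Module.Finite.iff_fg.1 inferInstance)
    have h2 : (LinearMap.ker l.rangeRestrict).FG :=
      Module.FinitePresentation.fg_ker _ l.surjective_rangeRestrict
    have : Module.Finite T (LinearMap.ker l.rangeRestrict) := Module.Finite.iff_fg.2 h2
    have : Module.FinitePresentation T (LinearMap.ker l.rangeRestrict) := by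
      refine Module.finitePresentation_of_injective (N := LinearMap.ker l.rangeRestrict) h
        (LinearMap.proj 0 ∘ₗ K.subtype ∘ₗ (LinearMap.ker l.rangeRestrict).subtype) ?_
      refine (injective_iff_map_eq_zero _).2 ?_
      rintro ⟨⟨x, hxK⟩, hx⟩ hx0
      ext i
      refine Fin.cases hx0 (fun i => ?_) i
      have := congrFun (congrArg Subtype.val (LinearMap.mem_ker.1 hx)) i
      exact this
    exact Module.finitePresentation_of_ker l.rangeRestrict l.surjective_rangeRestrict

theorem HasFGKernels.fg_ker (h : HasFGKernels T P) (e : T ≃ₗ[T] P) {n m : ℕ}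
    (f : (Fin n → T) →ₗ[T] (Fin m → P)) : (LinearMap.ker f).FG := by
  have := h.of_linearEquiv e.symm n m ((LinearEquiv.piCongrRight fun _ => e.symm).toLinearMap ∘ₗ f)
  rwa [LinearEquiv.ker_comp] at this

theorem HasFGKernels.finitePresentation (h : HasFGKernels T P) (e : T ≃ₗ[T] P) {n : ℕ}
    (K : Submodule T (Fin n → P)) (hK : K.FG) : Module.FinitePresentation T K := by
  obtain ⟨k, f, rfl⟩ := (Submodule.fg_iff_exists_fin_linearMap _ _).1 hK
  refine Module.finitePresentation_of_surjective f.rangeRestrict f.surjective_rangeRestrict ?_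
  rw [LinearMap.ker_rangeRestrict]
  exact h.fg_ker e f

theorem forall_fg_finitePresentation_iff_hasFGKernels (e : T ≃ₗ[T] P) :
    (∀ K : Submodule T P, K.FG → Module.FinitePresentation T K) ↔ HasFGKernels T P := by
  constructor
  · intro h n m f
    have : Module.Finite T P := Module.Finite.equiv e
    have : Module.FinitePresentation T (LinearMap.range f) :=
      Module.finitePresentation_of_fg_pi h m _ (Module.Finite.iff_fg.1 inferInstance)
    rw [← LinearMap.ker_rangeRestrict]
    exact Module.FinitePresentation.fg_ker _ f.surjective_rangeRestrict
  · intro h K hK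
    have : Module.Finite T K := Module.Finite.iff_fg.2 hK
    refine Module.finitePresentation_of_injective (h.finitePresentation e (n := 1))
      ((LinearMap.pi fun _ => LinearMap.id) ∘ₗ K.subtype) ?_
    intro x y hxy
    exact Subtype.ext (congrFun hxy 0)

end Coherence

/-! ### FP-injectivity as extension of maps -/

section Ext

variable {T : Type u} [Ring T] {L F P : Type u} [AddCommGroup L] [Module T L]
  [AddCommGroup F] [Module T F] [AddCommGroup P] [Module T P]

/-- In the long exact sequence of `0 → ker f → L → F → 0`, projectivity of `L` makes `Ext¹(F, P)`
the cokernel of the restriction `Hom(L, P) → Hom(ker f, P)`. -/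
theorem subsingleton_ext_one_iff [Module.Projective T L] (f : L →ₗ[T] F)
    (hf : Function.Surjective f) :
    Subsingleton (Abelian.Ext (ModuleCat.of T F) (ModuleCat.of T P) 1) ↔
      ∀ φ : LinearMap.ker f →ₗ[T] P, ∃ ψ : L →ₗ[T] P, ψ ∘ₗ (LinearMap.ker f).subtype = φ := by
  have hS := LinearMap.shortExact_shortComplexKer hf
  have : Projective f.shortComplexKer.X₂ := by
    dsimp
    infer_instance
  constructor
  · intro _ φ
    obtain ⟨x, hx⟩ := Abelian.Ext.contravariant_sequence_exact₁ hS (ModuleCat.of T P)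
      (Abelian.Ext.mk₀ (ModuleCat.ofHom φ)) rfl (Subsingleton.elim _ _)
    obtain ⟨ψ, rfl⟩ := Abelian.Ext.homEquiv₀.symm.surjective x
    refine ⟨ψ.hom, ?_⟩
    have : f.shortComplexKer.f ≫ ψ = ModuleCat.ofHom φ :=
      Abelian.Ext.homEquiv₀.symm.injective (by simpa using hx)
    exact congrArg ModuleCat.Hom.hom this
  · intro h
    refine subsingleton_of_forall_eq 0 fun x => ?_
    obtain ⟨y, rfl⟩ := precomp_extClass_surjective_of_projective_X₂ (ModuleCat.of T P) hS 0 x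
    obtain ⟨φ, rfl⟩ := Abelian.Ext.homEquiv₀.symm.surjective y
    obtain ⟨ψ, hψ⟩ := h φ.hom
    have : φ = f.shortComplexKer.f ≫ ModuleCat.ofHom ψ := by
      ext1
      exact hψ.symm
    subst this
    rw [Abelian.Ext.homEquiv₀_symm_apply, ← Abelian.Ext.mk₀_comp_mk₀]
    exact hS.extClass_comp_assoc (h := add_comm 1 0) _

/-- The cokernel of `f` is a finitely presented test module, and `g` induces a map on the range of
`f`. Conversely, the kernel in a finite presentation of `F` is itself the range of a map of finite
free modules. -/
theorem isFPInjectiveModule_iff_extendsFromImages (e : T ≃ₗ[T] P) :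
    IsFPInjectiveModule T P ↔ ExtendsFromImages T P := by
  constructor
  · intro h n m f g hfg
    have : Module.Finite T P := Module.Finite.equiv e
    have : Module.Free T P := Module.Free.of_equiv e
    have : Module.FinitePresentation T (Fin m → P) := Module.finitePresentation_of_projective _ _
    have hF : Module.FinitePresentation T ((Fin m → P) ⧸ LinearMap.range f) :=
      Module.finitePresentation_of_surjective (LinearMap.range f).mkQ
        (Submodule.mkQ_surjective _) (by
          rw [Submodule.ker_mkQ]
          exact Module.Finite.iff_fg.1 inferInstance)
    obtain ⟨ψ, hψ⟩ := (subsingleton_ext_one_iff (LinearMap.range f).mkQ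
      (Submodule.mkQ_surjective _)).1 (h _ hF)
        ((LinearMap.ker f).liftQ g hfg ∘ₗ f.quotKerEquivRange.symm.toLinearMap ∘ₗ
          (LinearEquiv.ofEq _ _ (Submodule.ker_mkQ _)).toLinearMap)
    refine ⟨ψ, LinearMap.ext fun x => ?_⟩
    have := LinearMap.congr_fun hψ ⟨f x, by simp⟩
    refine this.trans ?_
    have h2 : f.quotKerEquivRange.symm ⟨f x, LinearMap.mem_range_self f x⟩ =
        (LinearMap.ker f).mkQ x := by
      rw [LinearEquiv.symm_apply_eq]
      rfl
    exact (congrArg ((LinearMap.ker f).liftQ g hfg) h2).trans (by simp)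
  · intro h F _ _ hF
    obtain ⟨n, m, f, g, hf, hfg⟩ := hF.exists_fin'
    rw [subsingleton_ext_one_iff f hf]
    intro φ
    let g' : (Fin m → T) →ₗ[T] LinearMap.ker f := g.codRestrict _ hfg.apply_apply_eq_zero
    obtain ⟨k, hk⟩ := h.of_linearEquiv e.symm m n g (e.symm.toLinearMap ∘ₗ φ ∘ₗ g') (by
      intro x hx
      have : g' x = 0 := Subtype.ext hx
      simp [this])
    refine ⟨e.toLinearMap ∘ₗ k, LinearMap.ext fun ⟨x, hx⟩ => ?_⟩
    obtain ⟨y, rfl⟩ := (hfg x).1 hx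
    have := congrArg e (LinearMap.congr_fun hk y)
    simp only [LinearMap.comp_apply, LinearEquiv.coe_coe, LinearEquiv.apply_symm_apply] at this
    exact this

end Ext

/-! ### Duals of finitely presented modules as kernels of transposes -/

section Duality

variable {S T : Type*} [Ring S] [Ring T] {P : Type*} [AddCommGroup P] [Module S P] [Module T P]
  [SMulCommClass S T P]

variable (T P) in
/-- The `T`-linear map `Pⁿ → P`, `p ↦ ∑ i, x i • p i`, given by a row vector `x` over `S`. -/
def rowMap {n : ℕ} (x : Fin n → S) : (Fin n → P) →ₗ[T] P :=
  ∑ i, Module.toModuleEnd T (S := S) P (x i) ∘ₗ LinearMap.proj i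

theorem rowMap_apply {n : ℕ} (x : Fin n → S) (p : Fin n → P) :
    rowMap T P x p = ∑ i, x i • p i := by
  simp [rowMap]

theorem rowMap_surjective (hP : Function.Surjective (Module.toModuleEnd T (S := S) P)) {n : ℕ}
    (h : (Fin n → P) →ₗ[T] P) : ∃ x : Fin n → S, rowMap T P x = h := by
  choose s hs using hP
  refine ⟨fun i => s (h ∘ₗ LinearMap.single T (fun _ => P) i), ?_⟩
  ext i p
  simp [rowMap, hs, Pi.single_apply, apply_ite]

theorem rowMap_injective (hP : Function.Injective (Module.toModuleEnd T (S := S) P)) {n : ℕ} :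
    Function.Injective (rowMap T P : (Fin n → S) → _) := by
  intro x y hxy
  ext i
  apply hP
  ext p
  simpa [rowMap_apply, Pi.single_apply] using LinearMap.congr_fun hxy (Pi.single i p)

variable (T P) in
/-- The `T`-linear map `Hom_S(Sⁿ, P) = Pⁿ → Pᵐ = Hom_S(Sᵐ, P)` induced by `g : Sᵐ → Sⁿ`. -/
def transposeMap {n m : ℕ} (g : (Fin m → S) →ₗ[S] (Fin n → S)) :
    (Fin n → P) →ₗ[T] (Fin m → P) :=
  LinearMap.pi fun j => rowMap T P (g (Pi.single j 1))

theorem sum_smul_apply_single {M : Type*} [AddCommGroup M] [Module S M] {n : ℕ}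
    (g : (Fin n → S) →ₗ[S] M) (x : Fin n → S) : ∑ i, x i • g (Pi.single i 1) = g x := by
  conv_rhs => rw [pi_eq_sum_univ' x]
  simp [map_sum]

theorem rowMap_comp_transposeMap {n m : ℕ} (g : (Fin m → S) →ₗ[S] (Fin n → S)) (c : Fin m → S) :
    rowMap T P c ∘ₗ transposeMap T P g = rowMap T P (g c) := by
  refine LinearMap.ext fun p => ?_
  rw [← sum_smul_apply_single g c]
  simp only [LinearMap.comp_apply, rowMap_apply, transposeMap, LinearMap.pi_apply,
    Finset.smul_sum, Finset.sum_apply, Finset.sum_smul, Pi.smul_apply, smul_eq_mul, mul_smul]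
  exact Finset.sum_comm

theorem exists_transposeMap_eq (hP : Function.Surjective (Module.toModuleEnd T (S := S) P))
    {n m : ℕ} (f : (Fin n → P) →ₗ[T] (Fin m → P)) :
    ∃ g : (Fin m → S) →ₗ[S] (Fin n → S), transposeMap T P g = f := by
  choose a ha using fun j => rowMap_surjective hP (LinearMap.proj j ∘ₗ f)
  refine ⟨Fintype.linearCombination S a, LinearMap.ext fun p => funext fun j => ?_⟩
  simpa [transposeMap] using LinearMap.congr_fun (ha j) p

variable {M : Type*} [AddCommGroup M] [Module S M]

variable (T P) in
/-- The `T`-linear map `Hom_S(M, P) → Pⁿ = Hom_S(Sⁿ, P)` induced by `π : Sⁿ → M`. -/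
def dualToPi {n : ℕ} (π : (Fin n → S) →ₗ[S] M) : (M →ₗ[S] P) →ₗ[T] (Fin n → P) where
  toFun φ i := φ (π (Pi.single i 1))
  map_add' _ _ := rfl
  map_smul' _ _ := rfl

theorem rowMap_dualToPi {n : ℕ} (π : (Fin n → S) →ₗ[S] M) (x : Fin n → S) (φ : M →ₗ[S] P) :
    rowMap T P x (dualToPi T P π φ) = φ (π x) := by
  rw [rowMap_apply]
  exact sum_smul_apply_single (φ ∘ₗ π) x

theorem dualToPi_injective {n : ℕ} (π : (Fin n → S) →ₗ[S] M) (hπ : Function.Surjective π) :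
    Function.Injective (dualToPi T P π) := by
  intro φ ψ h
  ext m
  obtain ⟨x, rfl⟩ := hπ m
  rw [← rowMap_dualToPi (T := T), h, rowMap_dualToPi]

theorem range_dualToPi {n m : ℕ} (π : (Fin n → S) →ₗ[S] M) (hπ : Function.Surjective π)
    (g : (Fin m → S) →ₗ[S] (Fin n → S)) (hg : Function.Exact g π) :
    LinearMap.range (dualToPi T P π) = LinearMap.ker (transposeMap T P g) := by
  ext p
  constructor
  · rintro ⟨φ, rfl⟩
    refine funext fun j => ?_
    refine (rowMap_dualToPi π _ φ).trans ?_
    rw [hg.apply_apply_eq_zero, map_zero, Pi.zero_apply]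
  · intro hp
    have hker : LinearMap.ker π ≤ LinearMap.ker (Fintype.linearCombination S p) := by
      intro x hx
      obtain ⟨c, rfl⟩ := (hg x).1 hx
      have := LinearMap.congr_fun (rowMap_comp_transposeMap (T := T) (P := P) g c) p
      rw [LinearMap.comp_apply, LinearMap.mem_ker.1 hp, map_zero, rowMap_apply] at this
      exact this.symm
    refine ⟨(LinearMap.ker π).liftQ (Fintype.linearCombination S p) hker ∘ₗ
      (π.quotKerEquivOfSurjective hπ).symm.toLinearMap, funext fun i => ?_⟩
    have h2 : (π.quotKerEquivOfSurjective hπ).symm (π (Pi.single i 1)) =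
        (LinearMap.ker π).mkQ (Pi.single i 1) := by
      rw [LinearEquiv.symm_apply_eq]
      rfl
    refine (congrArg ((LinearMap.ker π).liftQ _ hker) h2).trans ?_
    simp

/-- The dual is isomorphic to the kernel of the transpose of a presentation of `M`. -/
theorem finitePresentation_dual (hc : HasFGKernels T P) (e : T ≃ₗ[T] P)
    [hM : Module.FinitePresentation S M] : Module.FinitePresentation T (M →ₗ[S] P) := by
  obtain ⟨n, m, π, g, hπ, hg⟩ := hM.exists_fin'
  have := hc.finitePresentation e _ (hc n m (transposeMap T P g))
  exact Module.FinitePresentation.of_equiv ((LinearEquiv.ofInjective _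
    (dualToPi_injective (T := T) (P := P) π hπ)).trans
      (LinearEquiv.ofEq _ _ (range_dualToPi π hπ g hg))).symm

/-- Lift `m` to a row `x`. Since `rowMap x` vanishes on the kernel of the transpose of `g`, it
factors through that transpose, so `rowMap x = rowMap (g c)` for some `c`. Hence `x = g c` maps to
zero in `M`. -/
theorem eq_zero_of_forall_dual (hi : ExtendsFromImages T P)
    (hP : Function.Bijective (Module.toModuleEnd T (S := S) P))
    [hM : Module.FinitePresentation S M] (m : M) (hm : ∀ φ : M →ₗ[S] P, φ m = 0) : m = 0 := by
  obtain ⟨n, k, π, g, hπ, hg⟩ := hM.exists_fin'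
  obtain ⟨x, rfl⟩ := hπ m
  obtain ⟨h, hh⟩ := hi n k (transposeMap T P g) (rowMap T P x) (fun p hp => by
    rw [← range_dualToPi π hπ g hg] at hp
    obtain ⟨φ, rfl⟩ := hp
    rw [LinearMap.mem_ker, rowMap_dualToPi, hm])
  obtain ⟨c, rfl⟩ := rowMap_surjective hP.2 h
  rw [rowMap_comp_transposeMap] at hh
  rw [← rowMap_injective hP.1 hh]
  exact hg.apply_apply_eq_zero c

/-- Embedded in `Pⁿ`, the dual is a kernel, hence by coherence the image of some `Pˡ`.
FP-injectivity then extends `Φ` to all of `Pⁿ`, where it is given by a row `x`, and `π x` is the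
required element. -/
theorem exists_eq_eval (hc : HasFGKernels T P) (e : T ≃ₗ[T] P) (hi : ExtendsFromImages T P)
    (hP : Function.Surjective (Module.toModuleEnd T (S := S) P))
    [hM : Module.FinitePresentation S M] (Φ : (M →ₗ[S] P) →ₗ[T] P) :
    ∃ m : M, ∀ φ, φ m = Φ φ := by
  obtain ⟨n, k, π, g, hπ, hg⟩ := hM.exists_fin'
  have hfg := hc n k (transposeMap T P g)
  rw [← range_dualToPi π hπ g hg] at hfg
  obtain ⟨l, f, hf⟩ := (Submodule.fg_iff_exists_fin_linearMap _ _).1 hfg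
  let E := LinearEquiv.ofInjective _ (dualToPi_injective (T := T) (P := P) π hπ)
  let f' : (Fin l → P) →ₗ[T] (Fin n → P) :=
    f ∘ₗ (LinearEquiv.piCongrRight fun _ => e).symm.toLinearMap
  have hf' : LinearMap.range f' = LinearMap.range (dualToPi T P π) := by
    rw [← hf]
    exact LinearEquiv.range_comp _ _
  let f'' := f'.codRestrict (LinearMap.range (dualToPi T P π))
    (fun y => hf' ▸ LinearMap.mem_range_self f' y)
  obtain ⟨h, hh⟩ := hi l n f' (Φ ∘ₗ E.symm.toLinearMap ∘ₗ f'') (fun y hy => by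
    have : f'' y = 0 := Subtype.ext hy
    simp [this])
  obtain ⟨x, rfl⟩ := rowMap_surjective hP h
  refine ⟨π x, fun φ => ?_⟩
  obtain ⟨y, hy⟩ : dualToPi T P π φ ∈ LinearMap.range f' := hf' ▸ LinearMap.mem_range_self _ φ
  rw [← rowMap_dualToPi (T := T), ← hy]
  refine (LinearMap.congr_fun hh y).trans ?_
  have : f'' y = E φ := Subtype.ext hy
  simp [this]

/-- Every map `Pⁿ → Pᵐ` is the transpose of some `g`, and its kernel is the dual of the cokernel of
`g`. -/
theorem hasFGKernels_of_dual {S T P : Type u} [Ring S] [Ring T] [AddCommGroup P] [Module S P]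
    [Module T P] [SMulCommClass S T P]
    (hP : Function.Surjective (Module.toModuleEnd T (S := S) P))
    (h : ∀ (M : Type u) [AddCommGroup M] [Module S M], Module.FinitePresentation S M →
      Module.FinitePresentation T (M →ₗ[S] P)) : HasFGKernels T P := by
  intro n m f
  obtain ⟨g, rfl⟩ := exists_transposeMap_eq hP f
  have := h ((Fin n → S) ⧸ LinearMap.range g) (Module.finitePresentation_of_surjective _
    (LinearMap.range g).mkQ_surjective (by
      rw [Submodule.ker_mkQ]
      exact Module.Finite.iff_fg.1 inferInstance))
  rw [← range_dualToPi (LinearMap.range g).mkQ (LinearMap.range g).mkQ_surjective g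
    (LinearMap.exact_map_mkQ_range g)]
  exact Module.Finite.iff_fg.1 inferInstance

/-- Write the two maps as the transpose of `g` and the row map of `x`. The kernel inclusion says
that all functionals kill the class of `x` in the cokernel of `g`, so `x = g c`, and `rowMap c` is
the extension. -/
theorem extendsFromImages_of_dual {S T P : Type u} [Ring S] [Ring T] [AddCommGroup P] [Module S P]
    [Module T P] [SMulCommClass S T P]
    (hP : Function.Surjective (Module.toModuleEnd T (S := S) P))
    (h : ∀ (M : Type u) [AddCommGroup M] [Module S M], Module.FinitePresentation S M →
      ∀ m : M, (∀ φ : M →ₗ[S] P, φ m = 0) → m = 0) : ExtendsFromImages T P := by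
  intro n m f f' hff'
  obtain ⟨g, rfl⟩ := exists_transposeMap_eq hP f
  obtain ⟨x, rfl⟩ := rowMap_surjective hP f'
  have hx := h ((Fin n → S) ⧸ LinearMap.range g) (Module.finitePresentation_of_surjective _
    (LinearMap.range g).mkQ_surjective (by
      rw [Submodule.ker_mkQ]
      exact Module.Finite.iff_fg.1 inferInstance)) ((LinearMap.range g).mkQ x) (fun φ => by
    rw [← rowMap_dualToPi (T := T)]
    apply hff'
    rw [← range_dualToPi (LinearMap.range g).mkQ (LinearMap.range g).mkQ_surjective g
      (LinearMap.exact_map_mkQ_range g)]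
    exact LinearMap.mem_range_self _ φ)
  obtain ⟨c, rfl⟩ : x ∈ LinearMap.range g := by simpa using hx
  exact ⟨rowMap T P c, rowMap_comp_transposeMap g c⟩

end Duality

/-! ### Ring conditions in matrix form -/

section Rings

variable (S : Type u) [Ring S]

theorem isLeftCoherent_iff : IsLeftCoherent S ↔ HasFGLeftAnnihilators S :=
  (forall_fg_finitePresentation_iff_hasFGKernels (.refl S S)).trans (hasFGKernels_iff (.refl S S))

theorem isRightCoherent_iff : IsRightCoherent S ↔ HasFGLeftAnnihilators Sᵐᵒᵖ :=
  (forall_fg_finitePresentation_iff_hasFGKernels (MulOpposite.opLinearEquiv Sᵐᵒᵖ).symm).trans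
    (hasFGKernels_iff (MulOpposite.opLinearEquiv Sᵐᵒᵖ).symm)

theorem isLeftFPInjective_iff : IsLeftFPInjective S ↔ HasDoubleAnnihilators S :=
  (isFPInjectiveModule_iff_extendsFromImages (.refl S S)).trans
    (extendsFromImages_iff (.refl S S))

theorem isRightFPInjective_iff : IsRightFPInjective S ↔ HasDoubleAnnihilators Sᵐᵒᵖ :=
  (isFPInjectiveModule_iff_extendsFromImages (MulOpposite.opLinearEquiv Sᵐᵒᵖ).symm).trans
    (extendsFromImages_iff (MulOpposite.opLinearEquiv Sᵐᵒᵖ).symm)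

theorem isCoherentFPInjective_iff : IsCoherentFPInjective S ↔
    (HasFGLeftAnnihilators S ∧ HasDoubleAnnihilators S) ∧
      HasFGLeftAnnihilators Sᵐᵒᵖ ∧ HasDoubleAnnihilators Sᵐᵒᵖ := by
  rw [← isLeftCoherent_iff, ← isRightCoherent_iff, ← isLeftFPInjective_iff,
    ← isRightFPInjective_iff]
  exact ⟨fun ⟨h1, h2, h3, h4⟩ => ⟨⟨h1, h3⟩, h2, h4⟩, fun ⟨⟨h1, h3⟩, h2, h4⟩ => ⟨h1, h2, h3, h4⟩⟩

theorem bijective_toModuleEnd_left :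
    Function.Bijective (Module.toModuleEnd Sᵐᵒᵖ (S := S) S) := by
  refine ⟨fun a b h => by simpa using LinearMap.congr_fun h 1, fun f => ⟨f 1, ?_⟩⟩
  ext
  simp

theorem bijective_toModuleEnd_right :
    Function.Bijective (Module.toModuleEnd S (S := Sᵐᵒᵖ) S) := by
  refine ⟨fun a b h => by simpa using LinearMap.congr_fun h 1, fun f => ⟨.op (f 1), ?_⟩⟩
  ext
  simp

theorem isWeaklyQuasiFrobenius_iff : IsWeaklyQuasiFrobenius S ↔
    (HasFGLeftAnnihilators S ∧ HasDoubleAnnihilators S) ∧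
      HasFGLeftAnnihilators Sᵐᵒᵖ ∧ HasDoubleAnnihilators Sᵐᵒᵖ := by
  let e : Sᵐᵒᵖ ≃ₗ[Sᵐᵒᵖ] S := (MulOpposite.opLinearEquiv Sᵐᵒᵖ).symm
  rw [← hasFGKernels_iff e, ← extendsFromImages_iff e, ← hasFGKernels_iff (.refl S S),
    ← extendsFromImages_iff (.refl S S)]
  have hl := bijective_toModuleEnd_left S
  have hr := bijective_toModuleEnd_right S
  constructor
  · rintro ⟨h1, h2, h3, h4⟩
    -- The sides cross: left matrix conditions come from right modules and conversely. Only
    -- injectivity of the evaluation maps is needed here.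
    refine ⟨⟨hasFGKernels_of_dual hr.2 h2, extendsFromImages_of_dual hr.2 fun M _ _ hM m hm => ?_⟩,
      hasFGKernels_of_dual hl.2 h1, extendsFromImages_of_dual hl.2 fun M _ _ hM m hm => ?_⟩
    · exact (injective_iff_map_eq_zero _).1 (h4 M hM).1 m (LinearMap.ext hm)
    · exact (injective_iff_map_eq_zero _).1 (h3 M hM).1 m (LinearMap.ext hm)
  · rintro ⟨⟨h1, h2⟩, h3, h4⟩
    refine ⟨fun M _ _ hM => finitePresentation_dual h3 e,
      fun M _ _ hM => finitePresentation_dual h1 (.refl S S), fun M _ _ hM => ⟨?_, ?_⟩,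
      fun M _ _ hM => ⟨?_, ?_⟩⟩
    · exact (injective_iff_map_eq_zero _).2 fun m hm =>
        eq_zero_of_forall_dual h4 hl m (LinearMap.congr_fun hm)
    · intro Φ
      obtain ⟨m, hm⟩ := exists_eq_eval h3 e h4 hl.2 Φ
      exact ⟨m, LinearMap.ext hm⟩
    · exact (injective_iff_map_eq_zero _).2 fun m hm =>
        eq_zero_of_forall_dual h2 hr m (LinearMap.congr_fun hm)
    · intro Φ
      obtain ⟨m, hm⟩ := exists_eq_eval h1 (.refl S S) h2 hr.2 Φ
      exact ⟨m, LinearMap.ext hm⟩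

end Rings

/-! ### Descent from `R(G)` to `R` and to local finiteness -/

section GroupAlgebra

variable {R : Type u} [Ring R] {G : Type v} [Group G]

theorem IsLocallyFiniteGroup.of_mulEquiv {G' : Type*} [Group G'] (e : G ≃* G')
    (h : IsLocallyFiniteGroup G) : IsLocallyFiniteGroup G' := by
  intro H hH
  obtain ⟨s, rfl⟩ := hH
  have := h ((Subgroup.closure (s : Set G')).map e.symm.toMonoidHom) (by
    rw [MonoidHom.map_closure]
    exact (Subgroup.fg_iff _).2 ⟨_, rfl, s.finite_toSet.image _⟩)
  exact @Finite.of_equiv _ _ this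
    (e.symm.subgroupMap (Subgroup.closure (s : Set G'))).symm.toEquiv

theorem isLocallyFiniteGroup_mulOpposite_iff :
    IsLocallyFiniteGroup Gᵐᵒᵖ ↔ IsLocallyFiniteGroup G :=
  ⟨.of_mulEquiv (MulEquiv.inv' G).symm, .of_mulEquiv (MulEquiv.inv' G)⟩

variable (R G) in
/-- The augmentation map of the group ring. -/
noncomputable def augmentation : MonoidAlgebra R G →+* R :=
  MonoidAlgebra.liftNCRingHom (RingHom.id R) (1 : G →* R) fun _ _ => Commute.one_right _

theorem augmentation_single (g : G) (r : R) : augmentation R G (.single g r) = r := by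
  simp [augmentation]

theorem HasFGLeftAnnihilators.of_monoidAlgebra (h : HasFGLeftAnnihilators (MonoidAlgebra R G)) :
    HasFGLeftAnnihilators R := by
  intro n m A
  let ι : R →+* MonoidAlgebra R G := MonoidAlgebra.singleOneRingHom
  have hA : (A.map ι).map (augmentation R G) = A := by
    ext i j
    exact augmentation_single 1 _
  obtain ⟨k, B, hB, hx⟩ := h n m (A.map ι)
  refine ⟨k, B.map (augmentation R G), ?_, fun x hxA => ?_⟩
  · rw [← hA, ← Matrix.map_mul, hB, Matrix.map_zero _ (map_zero _)]
  · obtain ⟨z, hz⟩ := hx (ι ∘ x) (by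
      ext1 j
      rw [← RingHom.map_vecMul, hxA, Pi.zero_apply, Pi.zero_apply, map_zero])
    refine ⟨augmentation R G ∘ z, ?_⟩
    ext j
    rw [← RingHom.map_vecMul, hz]
    exact augmentation_single 1 _

/-- The matrix and the column have entries in `R`, so a row over `R(G)` kills either of them exactly
when each of its coefficient rows does. A solution over `R(G)` is sent to one over `R` by
augmentation. -/
theorem HasDoubleAnnihilators.of_monoidAlgebra (h : HasDoubleAnnihilators (MonoidAlgebra R G)) :
    HasDoubleAnnihilators R := by
  intro n m A b hb
  let ι : R →+* MonoidAlgebra R G := MonoidAlgebra.singleOneRingHom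
  have hA : (A.map ι).map (augmentation R G) = A := by
    ext i j
    exact augmentation_single 1 _
  have hcoeff : ∀ {l : ℕ} (x : Fin l → MonoidAlgebra R G) (a : Fin l → R) (g : G),
      (x ⬝ᵥ (ι ∘ a)).coeff g = (fun i => (x i).coeff g) ⬝ᵥ a := by
    intro l x a g
    simp [dotProduct, MonoidAlgebra.coeff_sum, ι, Finsupp.finsetSum_apply]
  obtain ⟨c, hc⟩ := h n m (A.map ι) (ι ∘ b) (fun x hx => by
    ext g
    rw [hcoeff]
    refine hb _ (funext fun j => ?_)
    exact (hcoeff x (fun i => A i j) g).symm.trans (by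
      have := congrArg (fun y => MonoidAlgebra.coeff y g) (congrFun hx j)
      exact this))
  refine ⟨augmentation R G ∘ c, ?_⟩
  ext i
  have := RingHom.map_mulVec (augmentation R G) (A.map ι) c i
  rw [hA, hc] at this
  exact this.symm.trans (augmentation_single 1 _)

/-- An `x` with `x (g - 1) = 0` for all generators `g` of the subgroup has coefficients constant on
its left cosets. If the subgroup is infinite, finite support gives `x = 0`, so `1` would be a
combination `∑ (g - 1) c_g`. Augmentation turns this into `0 = 1` in `R`. -/
theorem HasDoubleAnnihilators.isLocallyFiniteGroup [Nontrivial R]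
    (h : HasDoubleAnnihilators (MonoidAlgebra R G)) : IsLocallyFiniteGroup G := by
  rintro H ⟨s, rfl⟩
  by_contra hH
  rw [not_finite_iff_infinite] at hH
  obtain ⟨c, hc⟩ := h.exists_mulVec_eq
    (Matrix.of fun (_ : Unit) (g : s) => MonoidAlgebra.single (g : G) (1 : R) - 1) 1 (by
      intro x hx
      have hs : ∀ g ∈ s, ∀ k, (x ()).coeff (k * g) = (x ()).coeff k := by
        intro g hg k
        have h1 : x () * (MonoidAlgebra.single g (1 : R) - 1) = 0 := by
          simpa [Matrix.vecMul, dotProduct] using congrFun hx ⟨g, hg⟩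
        rw [mul_sub, mul_one, sub_eq_zero] at h1
        conv_rhs => rw [← mul_inv_cancel_right k g, mul_assoc]
        conv_lhs => rw [← h1]
        simp
      have hcl : ∀ g ∈ Subgroup.closure (s : Set G), ∀ k,
          (x ()).coeff (k * g) = (x ()).coeff k := by
        intro g hg
        induction hg using Subgroup.closure_induction with
        | mem g hg => exact hs g hg
        | one => simp
        | mul a b _ _ ha hb => intro k; rw [← mul_assoc, hb, ha]
        | inv a _ ha => intro k; rw [← ha (k * a⁻¹), inv_mul_cancel_right]
      have hx0 : x () = 0 := by
        ext k
        by_contra hk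
        refine not_injective_infinite_finite
          (fun g : Subgroup.closure (s : Set G) => (⟨k * g, by
            rw [Finsupp.mem_support_iff, hcl g g.2]
            exact hk⟩ : (x ()).coeff.support)) ?_
        intro a b hab
        simpa using hab
      simp [dotProduct, hx0])
  have h1 := congrArg (augmentation R G) (congrFun hc ())
  simp [Matrix.mulVec, dotProduct, augmentation_single] at h1

/-! ### Ascent to `R(G)` through finite subgroups -/

theorem IsLocallyFiniteGroup.exists_finite_subgroup (h : IsLocallyFiniteGroup G) {ι : Type*}
    [Finite ι] (a : ι → MonoidAlgebra R G) :
    ∃ H : Subgroup G, Finite H ∧ ∀ i, ∀ g ∉ H, (a i).coeff g = 0 := by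
  classical
  cases nonempty_fintype ι
  let s : Finset G := Finset.univ.biUnion fun i => (a i).coeff.support
  refine ⟨Subgroup.closure (s : Set G), h _ ⟨s, rfl⟩, fun i g hg => ?_⟩
  by_contra hne
  refine hg (Subgroup.subset_closure ?_)
  simp only [s, Finset.coe_biUnion, Set.mem_iUnion]
  exact ⟨i, by simp, by simpa using hne⟩

section FiniteSubgroup

variable (H : Subgroup G) [Fintype H] {ι κ : Type*} [Fintype ι]

/-- The element of the group ring with the given coefficients on `H`. -/
noncomputable def ofSubgroup (y : H → R) : MonoidAlgebra R G :=
  ∑ h : H, MonoidAlgebra.single (h : G) (y h)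

theorem coeff_ofSubgroup (y : H → R) (h : H) : (ofSubgroup H y).coeff h = y h := by
  classical
  simp [ofSubgroup, MonoidAlgebra.coeff_sum, Finsupp.finsetSum_apply, Finsupp.single_apply]

theorem coeff_ofSubgroup_of_notMem (y : H → R) {g : G} (hg : g ∉ H) :
    (ofSubgroup H y).coeff g = 0 := by
  simp only [ofSubgroup, MonoidAlgebra.coeff_sum, Finsupp.finsetSum_apply]
  refine Finset.sum_eq_zero fun h _ => ?_
  exact Finsupp.single_eq_of_ne fun e => hg (e ▸ h.2)

theorem eq_ofSubgroup (a : MonoidAlgebra R G) (ha : ∀ g ∉ H, a.coeff g = 0) :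
    a = ofSubgroup H fun h => a.coeff h := by
  ext g
  by_cases hg : g ∈ H
  · exact (coeff_ofSubgroup H (fun h => a.coeff h) ⟨g, hg⟩).symm
  · rw [ha g hg, coeff_ofSubgroup_of_notMem H _ hg]

theorem coeff_mul_of_finite_subgroup (x a : MonoidAlgebra R G) (ha : ∀ g ∉ H, a.coeff g = 0)
    (g : G) : (x * a).coeff g = ∑ h : H, x.coeff (g * h) * a.coeff (h : G)⁻¹ := by
  conv_lhs => rw [eq_ofSubgroup H a ha]
  simp only [ofSubgroup, Finset.mul_sum, MonoidAlgebra.coeff_sum, Finsupp.finsetSum_apply]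
  refine Fintype.sum_equiv (Equiv.inv H) _ _ fun h => ?_
  simp

/-- The matrix over `R` by which a matrix over the group ring acts on row vectors that are
supported on the finite subgroup `H`. -/
def flattenMatrix (A : Matrix ι κ (MonoidAlgebra R G)) : Matrix (ι × H) (κ × H) R :=
  Matrix.of fun i j => (A i.1 j.1).coeff ((i.2 : G)⁻¹ * j.2)

/-- Right multiplication by elements supported on `H` preserves each left coset `sH`, and in the
coordinates `h ↦ s * h` its matrix does not depend on `s`. -/
theorem vecMul_flattenMatrix (A : Matrix ι κ (MonoidAlgebra R G))
    (hA : ∀ i j, ∀ g ∉ H, (A i j).coeff g = 0) (x : ι → MonoidAlgebra R G) (s : G)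
    (j : κ) (h : H) :
    Matrix.vecMul (fun i : ι × H => (x i.1).coeff (s * i.2)) (flattenMatrix H A) (j, h) =
      (Matrix.vecMul x A j).coeff (s * h) := by
  simp only [Matrix.vecMul, dotProduct, flattenMatrix, Matrix.of_apply, Fintype.sum_prod_type,
    MonoidAlgebra.coeff_sum, Finsupp.finsetSum_apply]
  refine Finset.sum_congr rfl fun i _ => ?_
  rw [coeff_mul_of_finite_subgroup H _ _ (hA i j)]
  refine (Fintype.sum_equiv (Equiv.mulLeft h) _ _ fun k => ?_).symm
  simp [mul_assoc]

theorem vecMul_ofSubgroup_eq_zero (A : Matrix ι κ (MonoidAlgebra R G))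
    (hA : ∀ i j, ∀ g ∉ H, (A i j).coeff g = 0) (y : ι × H → R)
    (hy : Matrix.vecMul y (flattenMatrix H A) = 0) :
    Matrix.vecMul (fun i => ofSubgroup H fun h => y (i, h)) A = 0 := by
  ext j g
  have h1 := vecMul_flattenMatrix H A hA (fun i => ofSubgroup H fun h => y (i, h))
  by_cases hg : g ∈ H
  · have h2 := h1 1 j ⟨g, hg⟩
    simp only [one_mul, coeff_ofSubgroup] at h2
    rw [← h2]
    exact congrFun hy _
  -- The coset `gH` misses `H`, so the lifted row has only zero coefficients there.
  · have h2 := h1 g j 1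
    have h3 : (fun i : ι × H => (ofSubgroup H fun h => y (i.1, h)).coeff (g * i.2)) = 0 := by
      ext i
      exact coeff_ofSubgroup_of_notMem H _ fun hmem => hg ((H.mul_mem_cancel_right i.2.2).1 hmem)
    rw [h3, Matrix.zero_vecMul] at h2
    simpa using h2.symm

end FiniteSubgroup

/-- Finitely many rows over `R` generate the annihilator of the flattened matrix. A row `x` over
`R(G)` killing `A` restricts on each coset to a combination of them, and translating by coset
representatives reassembles `x`. -/
theorem HasFGLeftAnnihilators.monoidAlgebra (hR : HasFGLeftAnnihilators R)
    (hG : IsLocallyFiniteGroup G) : HasFGLeftAnnihilators (MonoidAlgebra R G) := by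
  classical
  intro n m A
  obtain ⟨H, hH, hA⟩ := hG.exists_finite_subgroup fun ij : Fin n × Fin m => A ij.1 ij.2
  replace hA : ∀ i j, ∀ g ∉ H, (A i j).coeff g = 0 := fun i j => hA (i, j)
  cases nonempty_fintype H
  obtain ⟨k, B, hB, hx⟩ := hR.exists_matrix (flattenMatrix H A)
  refine ⟨k, Matrix.of fun l i => ofSubgroup H fun h => B l (i, h), ?_, fun x hxA => ?_⟩
  · ext1 l j
    exact congrFun (vecMul_ofSubgroup_eq_zero H A hA (B l) (congrFun hB l)) j
  · have hw : ∀ s : G, ∃ z : Fin k → R,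
        Matrix.vecMul z B = fun i : Fin n × H => (x i.1).coeff (s * i.2) := fun s =>
      hx _ (funext fun jh => by
        rw [vecMul_flattenMatrix H A hA x s jh.1 jh.2, hxA]
        rfl)
    choose w hw using hw
    -- The finitely many cosets that meet the support of some `x i`.
    let Q : Finset (G ⧸ H) :=
      Finset.univ.biUnion fun i => (x i).coeff.support.image (QuotientGroup.mk : G → G ⧸ H)
    refine ⟨fun l => ∑ q ∈ Q, MonoidAlgebra.single q.out (w q.out l), ?_⟩
    ext i g
    have hsum : (Matrix.vecMul (fun l => ∑ q ∈ Q, MonoidAlgebra.single q.out (w q.out l))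
        (Matrix.of fun l i => ofSubgroup H fun h => B l (i, h)) i).coeff g =
        ∑ q ∈ Q, ∑ l, w q.out l * (ofSubgroup H fun h => B l (i, h)).coeff (q.out⁻¹ * g) := by
      rw [Finset.sum_comm]
      simp [Matrix.vecMul, dotProduct, Finset.sum_mul, MonoidAlgebra.coeff_sum,
        Finsupp.finsetSum_apply]
    have hq : ∀ q : G ⧸ H, ∑ l, w q.out l * (ofSubgroup H fun h => B l (i, h)).coeff (q.out⁻¹ * g)
        = if q = (g : G ⧸ H) then (x i).coeff g else 0 := by
      intro q
      split_ifs with hqg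
      · have hmem : q.out⁻¹ * g ∈ H := by
          rw [← QuotientGroup.eq, QuotientGroup.out_eq', hqg]
        have h1 := congrFun (hw q.out) (i, ⟨_, hmem⟩)
        simp only [mul_inv_cancel_left] at h1
        rw [← h1]
        refine Finset.sum_congr rfl fun l _ => ?_
        rw [coeff_ofSubgroup H _ ⟨_, hmem⟩]
      · refine Finset.sum_eq_zero fun l _ => ?_
        rw [coeff_ofSubgroup_of_notMem, mul_zero]
        rwa [← QuotientGroup.eq, QuotientGroup.out_eq']
    rw [hsum, Finset.sum_congr rfl fun q _ => hq q, Finset.sum_ite_eq']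
    split_ifs with hgQ
    · rfl
    · by_contra hne
      refine hgQ (Finset.mem_biUnion.2 ⟨i, Finset.mem_univ _, Finset.mem_image_of_mem _ ?_⟩)
      exact Finsupp.mem_support_iff.2 (Ne.symm hne)

theorem HasDoubleAnnihilators.monoidAlgebra (hR : HasDoubleAnnihilators R)
    (hG : IsLocallyFiniteGroup G) : HasDoubleAnnihilators (MonoidAlgebra R G) := by
  intro n m A b hb
  obtain ⟨H, hH, hAb⟩ := hG.exists_finite_subgroup
    (Sum.elim (fun ij : Fin n × Fin m => A ij.1 ij.2) b)
  have hA : ∀ i j, ∀ g ∉ H, (A i j).coeff g = 0 := fun i j => hAb (.inl (i, j))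
  have hb' : ∀ i, ∀ g ∉ H, (b i).coeff g = 0 := fun i => hAb (.inr i)
  cases nonempty_fintype H
  obtain ⟨c, hc⟩ := hR.exists_mulVec_eq (flattenMatrix H A)
    -- Row `(i, h)` of the flattened system is the equation `A c = b` in position `i` at the group
    -- element `h⁻¹`. This is why the solution below carries `h⁻¹`. Its solvability condition is the
    -- coefficient at `1` of the lifted row times `b`.
    (fun i => (b i.1).coeff (i.2 : G)⁻¹) (fun y hy => by
      have := congrArg (fun z => MonoidAlgebra.coeff z 1)
        (hb _ (vecMul_ofSubgroup_eq_zero H A hA y hy))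
      simp only [dotProduct, MonoidAlgebra.coeff_sum, Finsupp.finsetSum_apply,
        coeff_mul_of_finite_subgroup H _ _ (hb' _), one_mul, coeff_ofSubgroup] at this
      simpa [dotProduct, Fintype.sum_prod_type] using this)
  refine ⟨fun j => ∑ h : H, MonoidAlgebra.single (h : G)⁻¹ (c (j, h)), ?_⟩
  ext i g
  have hsum : (A.mulVec (fun j => ∑ h : H, MonoidAlgebra.single (h : G)⁻¹ (c (j, h))) i).coeff g =
      ∑ j, ∑ h : H, (A i j).coeff (g * h) * c (j, h) := by
    simp [Matrix.mulVec, dotProduct, Finset.mul_sum, MonoidAlgebra.coeff_sum,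
      Finsupp.finsetSum_apply]
  rw [hsum]
  by_cases hg : g ∈ H
  · have h1 := congrFun hc (i, ⟨g⁻¹, H.inv_mem hg⟩)
    simpa [Matrix.mulVec, dotProduct, flattenMatrix, Fintype.sum_prod_type] using h1
  · rw [hb' i g hg]
    refine Finset.sum_eq_zero fun j _ => Finset.sum_eq_zero fun h _ => ?_
    rw [hA, zero_mul]
    exact fun hmem => hg ((H.mul_mem_cancel_right h.2).1 hmem)

theorem hasFGLeftAnnihilators_and_hasDoubleAnnihilators_monoidAlgebra_iff [Nontrivial R] :
    (HasFGLeftAnnihilators (MonoidAlgebra R G) ∧ HasDoubleAnnihilators (MonoidAlgebra R G)) ↔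
      (HasFGLeftAnnihilators R ∧ HasDoubleAnnihilators R) ∧ IsLocallyFiniteGroup G :=
  ⟨fun ⟨h1, h2⟩ => ⟨⟨h1.of_monoidAlgebra, h2.of_monoidAlgebra⟩, h2.isLocallyFiniteGroup⟩,
    fun ⟨⟨h1, h2⟩, hG⟩ => ⟨h1.monoidAlgebra hG, h2.monoidAlgebra hG⟩⟩

/-- The opposite of `R(G)` is again a group ring, over `Rᵐᵒᵖ` and `Gᵐᵒᵖ`, and inversion identifies
`Gᵐᵒᵖ` with `G`. -/
theorem hasFGLeftAnnihilators_and_hasDoubleAnnihilators_monoidAlgebra_op_iff [Nontrivial R] :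
    (HasFGLeftAnnihilators (MonoidAlgebra R G)ᵐᵒᵖ ∧
        HasDoubleAnnihilators (MonoidAlgebra R G)ᵐᵒᵖ) ↔
      (HasFGLeftAnnihilators Rᵐᵒᵖ ∧ HasDoubleAnnihilators Rᵐᵒᵖ) ∧ IsLocallyFiniteGroup G := by
  rw [← isLocallyFiniteGroup_mulOpposite_iff,
    ← hasFGLeftAnnihilators_and_hasDoubleAnnihilators_monoidAlgebra_iff]
  let e : (MonoidAlgebra R G)ᵐᵒᵖ ≃+* MonoidAlgebra Rᵐᵒᵖ Gᵐᵒᵖ := MonoidAlgebra.opRingEquiv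
  exact ⟨fun ⟨h1, h2⟩ => ⟨h1.of_ringEquiv e, h2.of_ringEquiv e⟩,
    fun ⟨h1, h2⟩ => ⟨h1.of_ringEquiv e.symm, h2.of_ringEquiv e.symm⟩⟩

end GroupAlgebra

theorem mainTheorem3 (R : Type u) [Ring R] [Nontrivial R] (G : Type v) [Group G] :
    (IsWeaklyQuasiFrobenius (MonoidAlgebra R G) ↔
      IsWeaklyQuasiFrobenius R ∧ IsLocallyFiniteGroup G) ∧
    (IsCoherentFPInjective (MonoidAlgebra R G) ↔
      IsCoherentFPInjective R ∧ IsLocallyFiniteGroup G) := by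
  rw [isWeaklyQuasiFrobenius_iff, isWeaklyQuasiFrobenius_iff, isCoherentFPInjective_iff,
    isCoherentFPInjective_iff, hasFGLeftAnnihilators_and_hasDoubleAnnihilators_monoidAlgebra_iff,
    hasFGLeftAnnihilators_and_hasDoubleAnnihilators_monoidAlgebra_op_iff]
  tauto
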